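/- **Setting.** A base station with a uniform linear array of $N=2\tilde N+1$ antennas (spacing $d>0$, carrier wavelength $\lambda_c>0$, $\alpha=(\lambda_c/4\pi)^2$) serves $K$ single-antenna users in the presence of an eavesdropper. The near-field array response $\mathbf a(\theta,r)\in\mathbb C^N$ has entries $\exp\!\big(-j\tfrac{2\pi}{\lambda_c}(-nd\cos\theta+\tfrac{n^2d^2\sin^2\theta}{2r})\big)$, $n=-\tilde N,\dots,\tilde N$. User $k$ at angle $\theta_k$ and distance $d_k>0$ has channel $\mathbf h_k=\tfrac{\sqrt\alpha}{d_k}\mathbf a(\theta_k,d_k)$; put $\mathbf H_k=\mathbf h_k\mathbf h_k^H$. Let $\sigma_k^2,\sigma_{\mathrm E}^2,\sigma_{\mathrm s}^2>0$ be the noise powers at user $k$, at the eavesdropper and of the sensing echoes; let $\overline R_{\mathrm{info},k}\ge 0$ and $\overline R_{\mathrm{leak},k}>0$ be the rate and leakage thresholds, $\tilde R_{\mathrm{info},k}=2^{\overline R_{\mathrm{info},k}}-1$, $\tilde R_{\mathrm{leak},k}=2^{\overline R_{\mathrm{leak},k}}-1$; let $P_{\max}>0$ and $\Gamma_1,\Gamma_2\in\mathbb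 R$. The eavesdropper state is $\mathbf s=(\theta_{\mathrm E},d_{\mathrm E},v_x,v_y)$. From the previous estimate $\mathbf s^-$ (with positive distance) and its positive semidefinite covariance $\mathbf C^-$ one forms the prediction $\bar{\mathbf s}=\mathbf f(\mathbf s^-)+\mathbf n_{\mathrm e}$, where $\mathbf f(\mathbf s)=\big(\theta_{\mathrm E}+\tfrac{(v_y\cos\theta_{\mathrm E}-v_x\sin\theta_{\mathrm E})\Delta T}{d_{\mathrm E}},\ d_{\mathrm E}+(v_x\cos\theta_{\mathrm E}+v_y\sin\theta_{\mathrm E})\Delta T,\ v_x,\ v_y\big)$, $\Delta T>0$, and $\mathbf n_{\mathrm e}$ is a given noise value, and the predicted covariance $\hat{\mathbf C}=\mathbf F\mathbf C^-\mathbf F^T+\mathbf Q_{\mathrm e}$, where $\mathbf F$ is the Jacobian of $\mathbf f$ at $\mathbf s^-$ and $\mathbf Q_{\mathrm e}$ is a diagonal matrix with positive entries. Let $\bar\theta,\bar d$ be the predicted angle and distance, with $\bar d>0$, and $\bar{\mathbf a}=\mathbf a(\bar\theta,\bar d)$. Let $\mathbf G$ be the Jacobian at $\bar{\mathbf s}$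 of $\mathbf g(\mathbf s)=\big(2d_{\mathrm E}/c,\ -\tfrac2{\lambda_c}(v_x\cos\theta_{\mathrm E}+v_y\sin\theta_{\mathrm E}),\ \theta_{\mathrm E}\big)$, $c>0$. For a Hermitian $\mathbf Z\in\mathbb C^{N\times N}$ put $$\gamma(\mathbf Z)=\frac{\alpha^2\beta^2GN\,\bar{\mathbf a}^H\mathbf Z\bar{\mathbf a}}{\bar d^{4}\sigma_{\mathrm s}^2},\qquad \mathbf C(\mathbf Z)^{-1}=\hat{\mathbf C}^{-1}+\gamma(\mathbf Z)\,\mathbf G^T\mathrm{diag}(a_\tau^{-2},a_\nu^{-2},a_\theta^{-2})\,\mathbf G,$$ with radar cross-section $\beta\in\mathbb R$, number of sensing symbols $G\in\mathbb N$, and $a_\tau,a_\nu,a_\theta>0$. Let $\beta_d=9\hat{\mathbf C}_{22}$ and let $\beta_{\mathbf a}$ be the maximum of $\sum_{n=-\tilde N}^{\tilde N}\vartheta_n^2$ over $|\Delta\theta|\le 3\hat{\mathbf C}_{11}^{1/2}$, $|\Delta d|\le 3\hat{\mathbf C}_{22}^{1/2}$, where $\vartheta_n=\tfrac{2\pi}{\lambda_c}\big((nd\sin\bar\theta+\tfrac{n^2d^2}{2}\tfrac{\sin2\bar\theta}{\bar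 d})\Delta\theta-\tfrac{n^2d^2}{2}\tfrac{\sin^2\bar\theta}{\bar d^2}\Delta d\big)$. Put $\mathbf U=[\mathbf I_N\ \ \bar{\mathbf a}]\in\mathbb C^{N\times(N+1)}$. **Relaxed problem.** Minimize the power $\sum_k\mathrm{Tr}(\overline{\mathbf W}_k)+\mathrm{Tr}(\mathbf Z)$ over Hermitian matrices $\mathbf W_k,\mathbf Z,\overline{\mathbf W}_k,\overline{\mathbf Z}_k,\overline{\mathbf W}_{kk'}$ ($k\ne k'$) in $\mathbb C^{N\times N}$, over $e_k$, and over $\kappa_{1,k},\kappa_{2,k},\eta_k,\zeta_m\ge0$, subject to, for all $k$, all $k'\neq k$ and all $m\in\{1,2,3,4\}$ (with $\preceq$ the Loewner order and $\mathbf q_m$ the $m$-th unit vector of $\mathbb R^4$): * C1: $\mathrm{Tr}(\mathbf H_k\overline{\mathbf W}_k)-\tilde R_{\mathrm{info},k}\sum_{k'\ne k}\mathrm{Tr}(\mathbf H_k\overline{\mathbf W}_{kk'})-\tilde R_{\mathrm{info},k}\mathrm{Tr}(\mathbf H_k\overline{\mathbf Z}_k)-\tilde R_{\mathrm{info},k}\sigma_k^2e_k\ge0$;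 * C2a: $\begin{bmatrix}\kappa_{1,k}\mathbf I_N&\mathbf 0\\ \mathbf 0&-\kappa_{1,k}\beta_{\mathbf a}+\eta_k\end{bmatrix}-\mathbf U^H(\overline{\mathbf W}_k-\tilde R_{\mathrm{leak},k}\mathbf Z)\mathbf U\succeq\mathbf 0$; * C2b: $\begin{bmatrix}\kappa_{2,k}+1&\bar d\\ \bar d&-\kappa_{2,k}\beta_d+\bar d^2-\frac{\alpha\eta_k}{\tilde R_{\mathrm{leak},k}\sigma_{\mathrm E}^2}\end{bmatrix}\succeq\mathbf 0$; * C3: $e_k\in\{0,1\}$; C4: $\sum_ke_k\ge\Gamma_1$; * C5a: $\begin{bmatrix}\mathbf C(\mathbf Z)^{-1}&\mathbf q_m\\ \mathbf q_m^T&\zeta_m\end{bmatrix}\succeq\mathbf 0$; C5b: $\sum_m\zeta_m\le\Gamma_2$; * C7: $\overline{\mathbf W}_k\preceq e_kP_{\max}\mathbf I$, $\ \overline{\mathbf W}_k\succeq\mathbf W_k-(1-e_k)P_{\max}\mathbf I$, $\ \mathbf 0\preceq\overline{\mathbf W}_k\preceq\mathbf W_k$; * C8: $\overline{\mathbf Z}_k\preceq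 e_kP_{\max}\mathbf I$, $\ \overline{\mathbf Z}_k\succeq\mathbf Z-(1-e_k)P_{\max}\mathbf I$, $\ \mathbf 0\preceq\overline{\mathbf Z}_k\preceq\mathbf Z$; * C9: $\overline{\mathbf W}_{kk'}\preceq e_kP_{\max}\mathbf I$, $\ \overline{\mathbf W}_{kk'}\preceq e_{k'}P_{\max}\mathbf I$, $\ \overline{\mathbf W}_{kk'}\succeq\mathbf W_{k'}-(2-e_k-e_{k'})P_{\max}\mathbf I$, $\ \mathbf 0\preceq\overline{\mathbf W}_{kk'}\preceq\mathbf W_{k'}$. The problem before relaxation has in addition the constraint C6: $\mathrm{rank}(\mathbf W_k)\le1$ for all $k$. **Proposition (tightness of the semidefinite relaxation).** For every optimal solution of the relaxed problem there is an equivalent optimal solution of the relaxed problem, that is, one with the same scheduling variables $e_k$, the same power and the same tracking error $\mathrm{Tr}\,\mathbf C(\mathbf Z)$, whose beamforming matrices satisfy $\mathrm{rank}(\mathbf W_k^*)\le1$ for all $k$. In particular it is also optimal for the problem with the constraint C6, and the two problems have the same optimal value. -/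

import Mathlib

open scoped Matrix MatrixOrder ComplexOrder

noncomputable section

namespace ISAC

/-- The Jacobian matrix `(∂ fᵢ / ∂ sⱼ)` at `s`, by partial derivatives. -/
def jacobian {m n : ℕ} (f : (Fin n → ℝ) → (Fin m → ℝ)) (s : Fin n → ℝ) :
    Matrix (Fin m) (Fin n) ℝ :=
  Matrix.of fun i j => deriv (fun t : ℝ => f (Function.update s j t) i) (s j)

/-- The data, in one time slot, of a near-field system with `K` single-antenna users, one
eavesdropper and a base station with a uniform linear array of `2 * M + 1` antennas.
The eavesdropper state is the vector `(θ_E, d_E, v_x, v_y)`. -/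
structure System (K M : ℕ) where
  /-- carrier wavelength `λ_c` -/
  wavelength : ℝ
  wavelength_pos : 0 < wavelength
  /-- antenna spacing `d` -/
  spacing : ℝ
  spacing_pos : 0 < spacing
  /-- propagation speed `c` -/
  speed : ℝ
  speed_pos : 0 < speed
  /-- angles `θ_k` of the users -/
  userAngle : Fin K → ℝ
  /-- distances `d_k` of the users -/
  userDist : Fin K → ℝ
  userDist_pos : ∀ k, 0 < userDist k
  /-- noise powers `σ_k²` at the users -/
  userNoise : Fin K → ℝ
  userNoise_pos : ∀ k, 0 < userNoise k
  /-- noise power `σ_E²` at the eavesdropper -/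
  eveNoise : ℝ
  eveNoise_pos : 0 < eveNoise
  /-- noise power `σ_s²` of the sensing echoes at the base station -/
  echoNoise : ℝ
  echoNoise_pos : 0 < echoNoise
  /-- radar cross-section `β` of the eavesdropper -/
  crossSection : ℝ
  /-- number `G` of sensing symbols in the slot -/
  numSymbols : ℕ
  /-- the measurement-accuracy parameters `a_τ, a_ν, a_θ` -/
  accuracy : Fin 3 → ℝ
  accuracy_pos : ∀ i, 0 < accuracy i
  /-- length `ΔT` of a time slot -/
  slotLength : ℝ
  slotLength_pos : 0 < slotLength
  /-- estimated eavesdropper state `s[l-1]` of the previous slot -/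
  prevState : Fin 4 → ℝ
  prevState_dist_pos : 0 < prevState 1
  /-- covariance matrix `C[l-1]` of that estimate -/
  prevCov : Matrix (Fin 4) (Fin 4) ℝ
  prevCov_posSemidef : prevCov.PosSemidef
  /-- value of the state-evolution noise `n_e[l]` -/
  evolutionNoise : Fin 4 → ℝ
  /-- variances of the state-evolution noise (the diagonal of `Q_e`) -/
  evolutionVar : Fin 4 → ℝ
  evolutionVar_pos : ∀ i, 0 < evolutionVar i
  /-- required achievable rates of the users -/
  rateInfo : Fin K → ℝ
  rateInfo_nonneg : ∀ k, 0 ≤ rateInfo k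
  /-- tolerated information leakage rates -/
  rateLeak : Fin K → ℝ
  rateLeak_pos : ∀ k, 0 < rateLeak k
  /-- threshold `Γ₁` for the number of served users -/
  minServed : ℝ
  /-- threshold `Γ₂` for the tracking mean squared error -/
  maxTracking : ℝ
  /-- power bound `P_max` -/
  maxPower : ℝ
  maxPower_pos : 0 < maxPower

/-- Square complex matrices indexed by the antennas. -/
abbrev AntennaMatrix (M : ℕ) := Matrix (Fin (2 * M + 1)) (Fin (2 * M + 1)) ℂ

/-- Values of all the optimization variables. `pairW k k'` stands for the matrix
`W̄_{kk'}` and is used only for `k ≠ k'`. -/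
structure Variables (K M : ℕ) where
  /-- beamforming matrices `W_k` -/
  W : Fin K → AntennaMatrix M
  /-- covariance matrix `Z` of the sensing signal -/
  Z : AntennaMatrix M
  /-- scheduling variables `e_k` -/
  e : Fin K → ℝ
  /-- `W̄_k`, standing for `e_k W_k` -/
  barW : Fin K → AntennaMatrix M
  /-- `Z̄_k`, standing for `e_k Z` -/
  barZ : Fin K → AntennaMatrix M
  /-- `W̄_{kk'}`, standing for `e_k e_{k'} W_{k'}` -/
  pairW : Fin K → Fin K → AntennaMatrix M
  /-- `κ_{1,k}` -/
  kappa₁ : Fin K → ℝ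
  /-- `κ_{2,k}` -/
  kappa₂ : Fin K → ℝ
  /-- `η_k` -/
  eta : Fin K → ℝ
  /-- `ζ_m` -/
  zeta : Fin 4 → ℝ

namespace System

variable {K M : ℕ} (P : System K M)

/-! ### Channels -/

/-- `α = (λ_c / 4π)²` -/
def alpha : ℝ := (P.wavelength / (4 * Real.pi)) ^ 2

/-- The signed antenna index `n ∈ {-M, …, M}`. -/
def antennaIndex (i : Fin (2 * M + 1)) : ℝ := (i : ℝ) - (M : ℝ)

/-- The near-field array response vector `a(θ, r)`. -/
def arrayResponse (θ r : ℝ) : Fin (2 * M + 1) → ℂ := fun i =>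
  Complex.exp (-Complex.I * ((2 * Real.pi / P.wavelength *
    (-(antennaIndex i * P.spacing * Real.cos θ)
      + antennaIndex i ^ 2 * P.spacing ^ 2 * Real.sin θ ^ 2 / (2 * r)) : ℝ) : ℂ))

/-- The channel vector `h_k` of user `k`. -/
def userChannel (k : Fin K) : Fin (2 * M + 1) → ℂ :=
  ((Real.sqrt P.alpha / P.userDist k : ℝ) : ℂ) •
    P.arrayResponse (P.userAngle k) (P.userDist k)

/-- `H_k = h_k h_kᴴ` -/
def userChannelMatrix (k : Fin K) : AntennaMatrix M :=
  Matrix.vecMulVec (P.userChannel k) (star (P.userChannel k))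

/-! ### Tracking of the eavesdropper -/

/-- The noiseless state-evolution map `f`. -/
def evolution (s : Fin 4 → ℝ) : Fin 4 → ℝ :=
  ![s 0 + (s 3 * Real.cos (s 0) - s 2 * Real.sin (s 0)) * P.slotLength / s 1,
    s 1 + (s 2 * Real.cos (s 0) + s 3 * Real.sin (s 0)) * P.slotLength,
    s 2,
    s 3]

/-- The noiseless measurement map `g` (delay, Doppler frequency, angle). -/
def measurement (s : Fin 4 → ℝ) : Fin 3 → ℝ :=
  ![2 * s 1 / P.speed,
    -(2 / P.wavelength) * (s 2 * Real.cos (s 0) + s 3 * Real.sin (s 0)),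
    s 0]

/-- The predicted state `s[l|l-1]`. -/
def predState : Fin 4 → ℝ := P.evolution P.prevState + P.evolutionNoise

/-- The predicted angle of the eavesdropper. -/
def predAngle : ℝ := P.predState 0

/-- The predicted distance of the eavesdropper. -/
def predDist : ℝ := P.predState 1

/-- The covariance matrix `C[l|l-1] = F C[l-1] Fᵀ + Q_e` of the predicted state. -/
def predCov : Matrix (Fin 4) (Fin 4) ℝ :=
  jacobian P.evolution P.prevState * P.prevCov * (jacobian P.evolution P.prevState)ᵀ
    + Matrix.diagonal P.evolutionVar

/-- The array response at the predicted position of the eavesdropper. -/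
def predResponse : Fin (2 * M + 1) → ℂ := P.arrayResponse P.predAngle P.predDist

/-- The echo SNR `γ` at the predicted position for the sensing covariance matrix `Z`. -/
def snr (Z : AntennaMatrix M) : ℝ :=
  P.alpha ^ 2 * P.crossSection ^ 2 * (P.numSymbols : ℝ) * ((2 * M + 1 : ℕ) : ℝ)
      * (star P.predResponse ⬝ᵥ (Z *ᵥ P.predResponse)).re
    / (P.predDist ^ 4 * P.echoNoise)

/-- The inverse `Q_m⁻¹` of the measurement-noise covariance matrix, whose diagonal entries are
the inverses `γ / a²` of the measurement variances `a² / γ`. -/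
def measurementPrecision (Z : AntennaMatrix M) : Matrix (Fin 3) (Fin 3) ℝ :=
  Matrix.diagonal fun i => P.snr Z / P.accuracy i ^ 2

/-- The inverse `C⁻¹ = C[l|l-1]⁻¹ + Gᵀ Q_m⁻¹ G` of the posterior covariance matrix. -/
def posteriorPrecision (Z : AntennaMatrix M) : Matrix (Fin 4) (Fin 4) ℝ :=
  P.predCov⁻¹ + (jacobian P.measurement P.predState)ᵀ * P.measurementPrecision Z
    * jacobian P.measurement P.predState

/-- The tracking mean squared error `Tr C`. -/
def trackingError (Z : AntennaMatrix M) : ℝ := ((P.posteriorPrecision Z)⁻¹).trace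

/-! ### The uncertainty regions -/

/-- The linearized phase error `ϑ` at antenna `i`. -/
def phaseError (i : Fin (2 * M + 1)) (Δθ Δr : ℝ) : ℝ :=
  2 * Real.pi / P.wavelength *
    ((antennaIndex i * P.spacing * Real.sin P.predAngle
        + antennaIndex i ^ 2 * P.spacing ^ 2 / 2 * (Real.sin (2 * P.predAngle) / P.predDist)) * Δθ
      - antennaIndex i ^ 2 * P.spacing ^ 2 / 2
          * (Real.sin P.predAngle ^ 2 / P.predDist ^ 2) * Δr)

/-- The approximate correlation `φ̂ = N - ½ ∑ ϑ²`. -/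
def phiHat (Δθ Δr : ℝ) : ℝ :=
  ((2 * M + 1 : ℕ) : ℝ) - 1 / 2 * ∑ i : Fin (2 * M + 1), P.phaseError i Δθ Δr ^ 2

/-- The box of admissible errors of angle and distance, by the three-sigma rule. -/
def errorBox : Set (ℝ × ℝ) :=
  {p | |p.1| ≤ 3 * Real.sqrt (P.predCov 0 0) ∧ |p.2| ≤ 3 * Real.sqrt (P.predCov 1 1)}

/-- The squared radius `β_a` of the uncertainty region of the array response: the maximum of
the continuous function `2 N - 2 φ̂` on the compact set `errorBox`. -/
def betaA : ℝ :=
  sSup ((fun p : ℝ × ℝ => 2 * ((2 * M + 1 : ℕ) : ℝ) - 2 * P.phiHat p.1 p.2) '' P.errorBox)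

/-- `β_d = 9 σ_d²`, with the variance of the predicted distance. -/
def betaD : ℝ := 9 * P.predCov 1 1

/-! ### The optimization problem -/

/-- `R̃_info = 2 ^ R_info - 1` -/
def sinrInfo (k : Fin K) : ℝ := 2 ^ P.rateInfo k - 1

/-- `R̃_leak = 2 ^ R_leak - 1` -/
def sinrLeak (k : Fin K) : ℝ := 2 ^ P.rateLeak k - 1

/-- The `N × (N + 1)` matrix `U = [I, ā]`. -/
def U : Matrix (Fin (2 * M + 1)) (Fin (2 * M + 1) ⊕ Unit) ℂ :=
  Matrix.fromCols 1 (Matrix.replicateCol Unit P.predResponse)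

/-- `S̄_k = W̄_k - R̃_leak Z` -/
def barS (x : Variables K M) (k : Fin K) : AntennaMatrix M :=
  x.barW k - P.sinrLeak k • x.Z

/-- Constraint C1: the rate requirement. -/
def C1 (x : Variables K M) : Prop := ∀ k,
  0 ≤ (P.userChannelMatrix k * x.barW k).trace.re
      - P.sinrInfo k * ∑ k' ∈ Finset.univ.erase k, (P.userChannelMatrix k * x.pairW k k').trace.re
      - P.sinrInfo k * (P.userChannelMatrix k * x.barZ k).trace.re
      - P.sinrInfo k * P.userNoise k * x.e k

/-- Constraint C2a: the leakage requirement, robust in the array response. -/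
def C2a (x : Variables K M) : Prop := ∀ k,
  (Matrix.fromBlocks (x.kappa₁ k • (1 : AntennaMatrix M)) 0 0
        (Matrix.of fun _ _ : Unit => ((-(x.kappa₁ k) * P.betaA + x.eta k : ℝ) : ℂ))
      - P.Uᴴ * P.barS x k * P.U).PosSemidef

/-- Constraint C2b: the leakage requirement, robust in the distance. -/
def C2b (x : Variables K M) : Prop := ∀ k,
  (!![x.kappa₂ k + 1, P.predDist;
      P.predDist, -(x.kappa₂ k) * P.betaD + P.predDist ^ 2
        - P.alpha * x.eta k / (P.sinrLeak k * P.eveNoise)]).PosSemidef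

/-- Constraint C3: the scheduling variables are binary. -/
def C3 (x : Variables K M) : Prop := ∀ k, x.e k = 0 ∨ x.e k = 1

/-- Constraint C4: the number of served users. -/
def C4 (x : Variables K M) : Prop := P.minServed ≤ ∑ k, x.e k

/-- Constraint C5a: `ζ_m` bounds the `m`-th diagonal entry of `C`, as a Schur complement. -/
def C5a (x : Variables K M) : Prop := ∀ m : Fin 4,
  (Matrix.fromBlocks (P.posteriorPrecision x.Z)
      (Matrix.replicateCol Unit (Pi.single m (1 : ℝ)))
      (Matrix.replicateRow Unit (Pi.single m (1 : ℝ)))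
      (Matrix.of fun _ _ : Unit => x.zeta m)).PosSemidef

/-- Constraint C5b: the tracking requirement. -/
def C5b (x : Variables K M) : Prop := ∑ m, x.zeta m ≤ P.maxTracking

/-- Constraint C6: the beamforming matrices have rank at most one. -/
def C6 (x : Variables K M) : Prop := ∀ k, (x.W k).rank ≤ 1

/-- Constraints C7a-C7d, which link `W̄_k` with `e_k W_k` (Loewner order). -/
def C7 (x : Variables K M) : Prop := ∀ k,
  x.barW k ≤ (x.e k * P.maxPower) • (1 : AntennaMatrix M) ∧
  x.W k - ((1 - x.e k) * P.maxPower) • (1 : AntennaMatrix M) ≤ x.barW k ∧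
  x.barW k ≤ x.W k ∧
  0 ≤ x.barW k

/-- Constraints C8a-C8d, which link `Z̄_k` with `e_k Z` (Loewner order). -/
def C8 (x : Variables K M) : Prop := ∀ k,
  x.barZ k ≤ (x.e k * P.maxPower) • (1 : AntennaMatrix M) ∧
  x.Z - ((1 - x.e k) * P.maxPower) • (1 : AntennaMatrix M) ≤ x.barZ k ∧
  x.barZ k ≤ x.Z ∧
  0 ≤ x.barZ k

/-- Constraints C9a-C9e, which link `W̄_{kk'}` with `e_k e_{k'} W_{k'}` (Loewner order). -/
def C9 (x : Variables K M) : Prop := ∀ k k', k ≠ k' →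
  x.pairW k k' ≤ (x.e k * P.maxPower) • (1 : AntennaMatrix M) ∧
  x.pairW k k' ≤ (x.e k' * P.maxPower) • (1 : AntennaMatrix M) ∧
  x.W k' - ((2 - x.e k - x.e k') * P.maxPower) • (1 : AntennaMatrix M) ≤ x.pairW k k' ∧
  x.pairW k k' ≤ x.W k' ∧
  0 ≤ x.pairW k k'

/-- The domain of the variables: the matrix `Z` is Hermitian and the auxiliary scalars are
nonnegative. (All other matrices are Hermitian by the Loewner-order constraints.) -/
def Domain (x : Variables K M) : Prop :=
  x.Z.IsHermitian ∧ (∀ k, 0 ≤ x.kappa₁ k) ∧ (∀ k, 0 ≤ x.kappa₂ k) ∧ (∀ k, 0 ≤ x.eta k) ∧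
    (∀ m, 0 ≤ x.zeta m)

/-- The feasible points of the semidefinite relaxation (no rank constraint). -/
def RelaxedFeasible (x : Variables K M) : Prop :=
  Domain x ∧ P.C1 x ∧ P.C2a x ∧ P.C2b x ∧ C3 x ∧ P.C4 x ∧ P.C5a x ∧ P.C5b x ∧
    P.C7 x ∧ P.C8 x ∧ P.C9 x

/-- The feasible points of the problem before the relaxation: the rank constraint is kept. -/
def Feasible (x : Variables K M) : Prop := P.RelaxedFeasible x ∧ C6 x

end System

/-- The objective function: the power consumption `∑ Tr W̄_k + Tr Z`. -/
def power {K M : ℕ} (x : Variables K M) : ℝ :=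
  ∑ k, (x.barW k).trace.re + x.Z.trace.re

namespace System

variable {K M : ℕ} (P : System K M)

/-- Optimal solutions of the semidefinite relaxation. -/
def RelaxedOptimal (x : Variables K M) : Prop :=
  P.RelaxedFeasible x ∧ IsMinOn power {y | P.RelaxedFeasible y} x

/-- Optimal solutions of the problem with the rank constraint. -/
def Optimal (x : Variables K M) : Prop :=
  P.Feasible x ∧ IsMinOn power {y | P.Feasible y} x

/-- Two points are equivalent if they schedule the same users and have the same power
consumption and tracking error (hence agree in all three performance metrics). -/
def Equivalent (x y : Variables K M) : Prop :=
  x.e = y.e ∧ power x = power y ∧ P.trackingError x.Z = P.trackingError y.Z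

end System

end ISAC

end

namespace ISAC

open Matrix

/-! ### Compression of a positive semidefinite matrix along a vector. -/

section Compression

variable {n : Type*} [Fintype n]

/-! For `A ⪰ 0`, the matrix `B = A h hᴴ A / (hᴴ A h)` has rank at most one, satisfies `0 ⪯ B ⪯ A`
(`compression_nonneg`, `compression_le`) and keeps the power received along `h`: `hᴴ B h = hᴴ A h`
(`trace_vecMulVec_star_mul_compression`). Compress each `W̄_k` along the channel of user `k`, and
use the result both as `W_k` and as `W̄_k`. Every useful signal is unchanged, while interference,
leakage and power can only decrease, so the relaxed constraints survive
(`rankOnePoint_relaxedFeasible`). The sensing covariance and the schedule are untouched, hence so is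
the tracking error. Optimality of the original point forces equal power. No duality or KKT argument
is needed. -/

/-- The compression `A h hᴴ A / (hᴴ A h)` of `A` along `h`; it is zero if `hᴴ A h = 0`. -/
noncomputable def compression (A : Matrix n n ℂ) (h : n → ℂ) : Matrix n n ℂ :=
  (star h ⬝ᵥ (A *ᵥ h))⁻¹ • (A * vecMulVec h (star h) * A)

lemma trace_vecMulVec_star_mul (A : Matrix n n ℂ) (h : n → ℂ) :
    (vecMulVec h (star h) * A).trace = star h ⬝ᵥ (A *ᵥ h) := by
  rw [vecMulVec_mul, trace_vecMulVec, dotProduct_comm, dotProduct_mulVec]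

lemma vecMulVec_star_mul_mul_self (A : Matrix n n ℂ) (h : n → ℂ) :
    vecMulVec h (star h) * A * vecMulVec h (star h)
      = (star h ⬝ᵥ (A *ᵥ h)) • vecMulVec h (star h) := by
  rw [vecMulVec_mul, vecMulVec_mul_vecMulVec, dotProduct_mulVec, vecMulVec_smul]

lemma rank_compression_le_one (A : Matrix n n ℂ) (h : n → ℂ) :
    (compression A h).rank ≤ 1 := by
  classical
  have h₁ : compression A h
      = ((star h ⬝ᵥ (A *ᵥ h))⁻¹ • A) * vecMulVec h (star h) * A := by
    simp [compression]
  rw [h₁]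
  exact (rank_mul_le_left _ _).trans ((rank_mul_le_right _ _).trans (rank_vecMulVec_le _ _))

lemma trace_vecMulVec_star_mul_compression (A : Matrix n n ℂ) (h : n → ℂ) :
    (vecMulVec h (star h) * compression A h).trace = (vecMulVec h (star h) * A).trace := by
  rw [compression, Matrix.mul_smul, trace_smul, ← mul_assoc, ← mul_assoc,
    vecMulVec_star_mul_mul_self, Matrix.smul_mul, trace_smul, trace_vecMulVec_star_mul]
  by_cases ht : star h ⬝ᵥ (A *ᵥ h) = 0
  · simp [ht]
  · simp [ht]

lemma compression_nonneg {A : Matrix n n ℂ} (hA : 0 ≤ A) (h : n → ℂ) :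
    0 ≤ compression A h := by
  rw [nonneg_iff_posSemidef] at hA ⊢
  have h₁ := (posSemidef_vecMulVec_self_star h).conjTranspose_mul_mul_same A
  rw [hA.1.eq] at h₁
  exact h₁.smul (inv_nonneg.2 (hA.dotProduct_mulVec_nonneg h))

/-- This is Cauchy–Schwarz for the form of `A`. With `Q = h hᴴ` and `t = hᴴ A h ≠ 0`, the matrix
`t⁻¹ Q A` is the `A`-orthogonal projection onto the line of `h`, and the difference is the form of
`A` on the complementary part. -/
lemma compression_le {A : Matrix n n ℂ} (hA : 0 ≤ A) (h : n → ℂ) :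
    compression A h ≤ A := by
  classical
  rw [nonneg_iff_posSemidef] at hA
  rw [le_iff]
  by_cases ht : star h ⬝ᵥ (A *ᵥ h) = 0
  -- Since `0⁻¹ = 0`, the compression vanishes here.
  · simpa [compression, ht] using hA
  have hst : star (star h ⬝ᵥ (A *ᵥ h)) = star h ⬝ᵥ (A *ᵥ h) :=
    (IsSelfAdjoint.of_nonneg (hA.dotProduct_mulVec_nonneg h)).star_eq
  have hQ := vecMulVec_star_mul_mul_self A h
  have hQh : (vecMulVec h (star h))ᴴ = vecMulVec h (star h) :=
    (posSemidef_vecMulVec_self_star h).1.eq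
  rw [compression]
  generalize star h ⬝ᵥ (A *ᵥ h) = t at ht hst hQ
  generalize vecMulVec h (star h) = Q at hQ hQh
  have key := hA.conjTranspose_mul_mul_same (1 - t⁻¹ • (Q * A))
  convert key using 1
  -- By `Q A Q = t Q` the quadratic term of the expansion is `t⁻¹ A Q A`, which cancels one of the
  -- two cross terms.
  have h₁ : A * Q * A * Q * A = t • (A * Q * A) := by
    rw [mul_assoc A Q A, mul_assoc A (Q * A) Q, hQ]
    simp [mul_assoc]
  simp only [conjTranspose_sub, conjTranspose_one, conjTranspose_smul, star_inv₀, hst,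
    conjTranspose_mul, hQh, hA.1.eq, sub_mul, mul_sub, one_mul, mul_one, Matrix.smul_mul,
    Matrix.mul_smul,
    ← mul_assoc, h₁]
  rw [smul_smul t⁻¹ t, inv_mul_cancel₀ ht, one_smul]
  abel

lemma trace_vecMulVec_star_mul_re_mono {A B : Matrix n n ℂ} (hAB : A ≤ B) (h : n → ℂ) :
    (vecMulVec h (star h) * A).trace.re ≤ (vecMulVec h (star h) * B).trace.re := by
  have h₁ := (le_iff.1 hAB).dotProduct_mulVec_nonneg h
  rw [sub_mulVec, dotProduct_sub, sub_nonneg] at h₁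
  rw [trace_vecMulVec_star_mul, trace_vecMulVec_star_mul]
  exact (Complex.le_def.1 h₁).1

lemma trace_re_mono {A B : Matrix n n ℂ} (hAB : A ≤ B) : A.trace.re ≤ B.trace.re := by
  have h₁ := (le_iff.1 hAB).trace_nonneg
  rw [trace_sub, sub_nonneg] at h₁
  exact (Complex.le_def.1 h₁).1

end Compression

/-! ### The rank-one point and its feasibility. -/

namespace System

variable {K M : ℕ} (P : System K M)

lemma sinrInfo_nonneg (k : Fin K) : 0 ≤ P.sinrInfo k :=
  sub_nonneg.2 (Real.one_le_rpow one_le_two (P.rateInfo_nonneg k))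

/-- The beamforming matrix `W̄_k`, compressed along the channel of user `k`. -/
noncomputable def beam (x : Variables K M) (k : Fin K) : AntennaMatrix M :=
  compression (x.barW k) (P.userChannel k)

/-- The point with the same sensing signal and schedule as `x` whose beamforming matrices are
the compressions of those of `x`. -/
noncomputable def rankOnePoint (x : Variables K M) : Variables K M :=
  { x with
    W := P.beam x
    barW := P.beam x
    -- A factor `e_{k'}` would be redundant: the beam of an unscheduled user is zero by
    -- `beam_eq_zero`.
    pairW := fun k k' => if x.e k = 1 then P.beam x k' else 0 }

variable {P} {x : Variables K M}

lemma beam_nonneg (h : P.C7 x) (k : Fin K) : 0 ≤ P.beam x k :=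
  compression_nonneg (h k).2.2.2 _

lemma beam_le (h : P.C7 x) (k : Fin K) : P.beam x k ≤ x.barW k :=
  compression_le (h k).2.2.2 _

lemma beam_eq_zero (h : P.C7 x) {k : Fin K} (hk : x.e k = 0) : P.beam x k = 0 := by
  refine le_antisymm ((beam_le h k).trans ?_) (beam_nonneg h k)
  simpa [hk] using (h k).1

lemma smul_maxPower_nonneg {a : ℝ} (ha : 0 ≤ a) :
    (0 : AntennaMatrix M) ≤ (a * P.maxPower) • (1 : AntennaMatrix M) :=
  smul_nonneg (mul_nonneg ha P.maxPower_pos.le) zero_le_one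

/-- If both users are scheduled, the slack `2 - e_k - e_{k'}` in C9 is zero, so `W̄_{k'} ⪯ W_{k'} ⪯
W̄_{kk'}`. This is what makes the interference in C1 decrease. -/
lemma beam_le_pairW (h₃ : C3 x) (h₇ : P.C7 x) (h₉ : P.C9 x) {k k' : Fin K} (hne : k ≠ k')
    (hk : x.e k = 1) : P.beam x k' ≤ x.pairW k k' := by
  rcases h₃ k' with hk' | hk'
  · rw [beam_eq_zero h₇ hk']
    exact (h₉ k k' hne).2.2.2.2
  · refine (beam_le h₇ k').trans ((h₇ k').2.2.1.trans ?_)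
    have h := (h₉ k k' hne).2.2.1
    have h2 : (2 : ℝ) - 1 - 1 = 0 := by norm_num
    simpa only [hk, hk', h2, zero_mul, zero_smul, sub_zero] using h

lemma rankOnePoint_C1 (h₁ : P.C1 x) (h₃ : C3 x) (h₇ : P.C7 x) (h₈ : P.C8 x) (h₉ : P.C9 x) :
    P.C1 (P.rankOnePoint x) := by
  intro k
  rcases h₃ k with hk | hk
  · have hZ : x.barZ k = 0 :=
      le_antisymm (by simpa [hk] using (h₈ k).1) (h₈ k).2.2.2
    simp [rankOnePoint, beam_eq_zero h₇ hk, hk, hZ]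
  · refine (h₁ k).trans ?_
    have hs : (P.userChannelMatrix k * P.beam x k).trace
        = (P.userChannelMatrix k * x.barW k).trace :=
      trace_vecMulVec_star_mul_compression _ _
    have hI : ∑ k' ∈ Finset.univ.erase k, (P.userChannelMatrix k * P.beam x k').trace.re
        ≤ ∑ k' ∈ Finset.univ.erase k, (P.userChannelMatrix k * x.pairW k k').trace.re :=
      Finset.sum_le_sum fun k' hk' => trace_vecMulVec_star_mul_re_mono
        (beam_le_pairW h₃ h₇ h₉ (Finset.ne_of_mem_erase hk').symm hk) _
    simp only [rankOnePoint, hk, if_true, hs]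
    have := mul_le_mul_of_nonneg_left hI (P.sinrInfo_nonneg k)
    linarith

lemma rankOnePoint_C2a (h₂ : P.C2a x) (h₇ : P.C7 x) : P.C2a (P.rankOnePoint x) := by
  intro k
  -- The new C2a matrix is the old one plus `Uᴴ (W̄_k - B_k) U`, where `B_k` is the compressed beam.
  have h := (h₂ k).add ((le_iff.1 (beam_le h₇ k)).conjTranspose_mul_mul_same P.U)
  convert h using 1
  simp only [rankOnePoint, barS, Matrix.mul_sub, Matrix.sub_mul]
  abel

lemma rankOnePoint_C7 (h₃ : C3 x) (h₇ : P.C7 x) : P.C7 (P.rankOnePoint x) := by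
  intro k
  have he : 0 ≤ 1 - x.e k := by rcases h₃ k with hk | hk <;> simp [hk]
  exact ⟨(beam_le h₇ k).trans (h₇ k).1, sub_le_self _ (smul_maxPower_nonneg he), le_rfl,
    beam_nonneg h₇ k⟩

lemma rankOnePoint_C9 (h₃ : C3 x) (h₇ : P.C7 x) : P.C9 (P.rankOnePoint x) := by
  intro k k' _
  have hb := (beam_le h₇ k').trans (h₇ k').1
  have hn := beam_nonneg h₇ k'
  have he' : 0 ≤ x.e k' ∧ 0 ≤ 1 - x.e k' := by rcases h₃ k' with hk | hk <;> simp [hk]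
  rcases h₃ k with hk | hk
  · simp only [rankOnePoint, hk, zero_ne_one, if_false]
    refine ⟨smul_maxPower_nonneg le_rfl, smul_maxPower_nonneg he'.1, ?_, hn, le_rfl⟩
    rw [sub_nonpos]
    -- With `e_k = 0` the claim is `W_{k'} ⪯ (2 - e_{k'}) P_max I`. It holds because the new
    -- `W_{k'}` is itself bounded by `e_{k'} P_max I`, a bound not imposed on the old one.
    rcases h₃ k' with hk' | hk'
    · rw [beam_eq_zero h₇ hk', hk']
      exact smul_maxPower_nonneg (by norm_num)
    · rw [hk'] at hb ⊢
      convert hb using 3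
      norm_num
  · simp only [rankOnePoint, hk, if_true]
    refine ⟨hb.trans ?_, hb, sub_le_self _ (smul_maxPower_nonneg (by linarith)), le_rfl, hn⟩
    refine smul_le_smul_of_nonneg_right ?_ zero_le_one
    exact mul_le_mul_of_nonneg_right (by linarith) P.maxPower_pos.le

lemma rankOnePoint_relaxedFeasible (h : P.RelaxedFeasible x) :
    P.RelaxedFeasible (P.rankOnePoint x) := by
  obtain ⟨hD, h₁, h₂, h₂', h₃, h₄, h₅, h₅', h₇, h₈, h₉⟩ := h
  exact ⟨hD, rankOnePoint_C1 h₁ h₃ h₇ h₈ h₉, rankOnePoint_C2a h₂ h₇, h₂', h₃, h₄, h₅, h₅',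
    rankOnePoint_C7 h₃ h₇, h₈, rankOnePoint_C9 h₃ h₇⟩

lemma power_rankOnePoint_le (h₇ : P.C7 x) : power (P.rankOnePoint x) ≤ power x :=
  add_le_add_left (Finset.sum_le_sum fun k _ => trace_re_mono (beam_le h₇ k)) _

end System

end ISAC

theorem proposition1 {K M : ℕ} (P : ISAC.System K M) (hd : 0 < P.predDist)
    (x : ISAC.Variables K M) (hx : P.RelaxedOptimal x) :
    ∃ y : ISAC.Variables K M,
      P.RelaxedOptimal y ∧ P.Equivalent x y ∧ (∀ k, (y.W k).rank ≤ 1) ∧ P.Optimal y := by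
  obtain ⟨hf, hmin⟩ := hx
  have hyf := ISAC.System.rankOnePoint_relaxedFeasible hf
  have hle : ISAC.power (P.rankOnePoint x) ≤ ISAC.power x :=
    ISAC.System.power_rankOnePoint_le hf.2.2.2.2.2.2.2.2.1
  have hymin : IsMinOn ISAC.power {z | P.RelaxedFeasible z} (P.rankOnePoint x) :=
    fun z hz => hle.trans (hmin hz)
  have hrank : ∀ k, ((P.rankOnePoint x).W k).rank ≤ 1 :=
    fun k => ISAC.rank_compression_le_one _ _
  -- Minimality over the relaxed set passes to its rank-constrained subset.
  exact ⟨P.rankOnePoint x, ⟨hyf, hymin⟩, ⟨rfl, le_antisymm (hmin hyf) hle, rfl⟩, hrank,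
    ⟨hyf, hrank⟩, fun z hz => hymin hz.1⟩
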